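/- Let $d\ge 1$, let $f:\mathbb{R}^d\to[0,\infty)$ be a (Borel) probability density with respect to Lebesgue measure, and let $X_1,X_2,\dots$ be i.i.d. random vectors in $\mathbb{R}^d$ with density $f$. Let $\rho(x,y)=|x-y|$ be the Euclidean distance, $B(x,r)$ the closed ball of radius $r$ centred at $x$, and $V_d=\pi^{d/2}/\Gamma(\tfrac d2+1)$. For $N\ge 2$ put $\rho_i=\min_{1\le j\le N,\,j\ne i}\rho(X_i,X_j)$, $\overline\rho=(\rho_1\cdots\rho_N)^{1/N}$, and $$H_N=d\log\overline\rho+\log V_d+\gamma+\log(N-1),$$ where $\gamma$ is the Euler constant. Let $H=-\int_{\mathbb{R}^d} f(x)\log f(x)\,dx$ (with $0\log 0=0$). Put $G(t)=0$ for $0\le t<1$ and $G(t)=t\log t$ for $t\ge 1$, and for $x\in\mathbb{R}^d$, $R>0$ $$I_f(x,r)=\frac{1}{r^dV_d}\int_{B(x,r)}f(y)\,dy,\qquad M_f(x,R)=\sup_{0<r\le R}I_f(x,r),\qquad m_f(x,R)=\inf_{0<r\le R}I_f(x,r).$$ Assume that for some positive $\varepsilon_0,\varepsilon_1,\varepsilon_2,R_1,R_2$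 the following integrals are finite: $$K_f(\varepsilon_0)=\int_{\mathbb{R}^d}\Big(\int_{\mathbb{R}^d}G(|\log\rho(x,y)|)f(y)\,dy\Big)^{1+\varepsilon_0}f(x)\,dx,$$ $$Q_f(\varepsilon_1,R_1)=\int_{\mathbb{R}^d}M_f(x,R_1)^{\varepsilon_1}f(x)\,dx,\qquad T_f(\varepsilon_2,R_2)=\int_{\mathbb{R}^d}m_f(x,R_2)^{-\varepsilon_2}f(x)\,dx$$ (with $0^{-\varepsilon_2}=\infty$ and $\infty\cdot 0=0$). Then $f\log f$ is integrable, so that $H$ is finite; $H_N$ is integrable for all sufficiently large $N$; and $$\lim_{N\to\infty}\mathsf{E}H_N=H.$$ -/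

import Mathlib

open MeasureTheory ProbabilityTheory Filter Topology Set
open scoped ENNReal

noncomputable section

namespace KozachenkoLeonenko

/-- The volume `V_d = π^{d/2} / Γ(d/2 + 1)` of the unit ball of `ℝ^d`. -/
def unitBallVolume (d : ℕ) : ℝ :=
  Real.pi ^ ((d : ℝ) / 2) / Real.Gamma ((d : ℝ) / 2 + 1)

/-- `ρ_i`: the distance from `x i` to its nearest neighbour among the other points of the sample
(a minimum over a finite set, nonempty as soon as `2 ≤ N`). -/
def nnDist {d N : ℕ} (x : Fin N → EuclideanSpace ℝ (Fin d)) (i : Fin N) : ℝ :=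
  ⨅ j : {j : Fin N // j ≠ i}, dist (x i) (x j)

/-- The geometric mean `(ρ_1 ⋯ ρ_N)^{1/N}` of the nearest-neighbour distances. -/
def nnGeomMean {d N : ℕ} (x : Fin N → EuclideanSpace ℝ (Fin d)) : ℝ :=
  (∏ i, nnDist x i) ^ (1 / (N : ℝ))

/-- The estimate `d log ρ̄ + log V_d + γ + log (N - 1)`. For an i.i.d. sample from a density on
`ℝ^d`, `d ≥ 1`, almost surely `ρ̄ > 0`, so the value of `log` at `0` does not matter. -/
def estimator {d N : ℕ} (x : Fin N → EuclideanSpace ℝ (Fin d)) : ℝ :=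
  (d : ℝ) * Real.log (nnGeomMean x) + Real.log (unitBallVolume d)
    + Real.eulerMascheroniConstant + Real.log ((N : ℝ) - 1)

/-- The differential entropy `H(f) = -∫ f log f`, with `0 log 0 = 0`. -/
def entropy {d : ℕ} (f : EuclideanSpace ℝ (Fin d) → ℝ) : ℝ :=
  -∫ x, f x * Real.log (f x)

/-- `G(t) = 0` for `t < 1` and `G(t) = t log t` for `t ≥ 1`. -/
def G (t : ℝ) : ℝ := if t < 1 then 0 else t * Real.log t

/-- The mean `I_f(x, r)` of `f` over the closed ball `B(x, r)`. -/
def ballMean {d : ℕ} (f : EuclideanSpace ℝ (Fin d) → ℝ) (x : EuclideanSpace ℝ (Fin d)) (r : ℝ) :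
    ℝ≥0∞ :=
  (∫⁻ y in Metric.closedBall x r, ENNReal.ofReal (f y)) /
    ENNReal.ofReal (r ^ d * unitBallVolume d)

/-- The local maximal function `M_f(x, R)`, with values in `[0, ∞]`. -/
def localMax {d : ℕ} (f : EuclideanSpace ℝ (Fin d) → ℝ) (x : EuclideanSpace ℝ (Fin d)) (R : ℝ) :
    ℝ≥0∞ :=
  ⨆ r ∈ Ioc (0 : ℝ) R, ballMean f x r

/-- The local minimal function `m_f(x, R)`. -/
def localMin {d : ℕ} (f : EuclideanSpace ℝ (Fin d) → ℝ) (x : EuclideanSpace ℝ (Fin d)) (R : ℝ) :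
    ℝ≥0∞ :=
  ⨅ r ∈ Ioc (0 : ℝ) R, ballMean f x r

/-- `K_f(ε)`. The inner integrand at `y = x` does not matter, since `{x}` is a null set
when `d ≥ 1`. -/
def K {d : ℕ} (f : EuclideanSpace ℝ (Fin d) → ℝ) (ε : ℝ) : ℝ≥0∞ :=
  ∫⁻ x, (∫⁻ y, ENNReal.ofReal (G |Real.log (dist x y)|) * ENNReal.ofReal (f y)) ^ (1 + ε)
    * ENNReal.ofReal (f x)

/-- `Q_f(ε, R)`. -/
def Q {d : ℕ} (f : EuclideanSpace ℝ (Fin d) → ℝ) (ε R : ℝ) : ℝ≥0∞ :=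
  ∫⁻ x, localMax f x R ^ ε * ENNReal.ofReal (f x)

/-- `T_f(ε, R)`; here `0 ^ (-ε) = ∞` for `ε > 0`, and `∞ * 0 = 0`. -/
def T {d : ℕ} (f : EuclideanSpace ℝ (Fin d) → ℝ) (ε R : ℝ) : ℝ≥0∞ :=
  ∫⁻ x, localMin f x R ^ (-ε) * ENNReal.ofReal (f x)

end KozachenkoLeonenko

end

noncomputable section

namespace KozachenkoLeonenko

/-! ### The probability integral transform -/

/-! Let `μ` be the law with density `f`, let `ρ` be the nearest-neighbour distance of the first of
`N` sample points, and put `U = μ(B(X 0, ρ))`. The proof rests on the identity `d log ρ = log U -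
log V_d - log I_f(X 0, ρ)` (`log_toReal_ballMean`), whose two random terms are treated separately.

The first does not depend on `f`. Spheres are `μ`-null, so, given `X 0`, the masses `μ(B(X 0, |X j -
X 0|))` are independent and uniform, and `U` is the minimum of `N - 1` of them (`pi_le_nnBallProb`).
Thus `-log U` is a maximum of independent standard exponentials and its mean is exactly the harmonic
number of `N - 1` (`integral_log_nnBallProb`), which `γ + log (N - 1)` cancels in the limit.

The second is handled by dominated convergence (`tendsto_integral_log_ballMean_nnDist`). Almost
surely `ρ → 0`, so Lebesgue differentiation gives `log I_f(X 0, ρ) → log f(X 0)`. For radii up to a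
fixed `R`, powers of the local maximal and minimal functions bound the logarithm; for larger radii
the ball mass lies between `μ(B(X 0, R))` and `1`, and `ρ ≤ |X 0 - X 1|`. So one bound serves all
`N`, and it is integrable by the finiteness of `Q`, `T` and `K`. The limit obeys the same bound,
whence `f log f` is integrable.

By exchangeability the mean of the estimator involves the first point only (`integral_estimator`).
-/

lemma continuous_cdf (ν : Measure ℝ) [IsProbabilityMeasure ν] [NullSingletonClass ν] :
    Continuous (cdf ν) := by
  refine continuous_iff_continuousAt.2 fun a => ?_
  rw [(cdf ν).mono.continuousAt_iff_leftLim_eq_rightLim, (cdf ν).rightLim_eq]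
  refine le_antisymm ((cdf ν).mono.leftLim_le le_rfl) ?_
  have h := (cdf ν).measure_singleton a
  rw [measure_cdf, measure_singleton, eq_comm, ENNReal.ofReal_eq_zero] at h
  linarith

/-- An atomless real random variable composed with its distribution function is uniform. -/
lemma measure_le_cdf (ν : Measure ℝ) [IsProbabilityMeasure ν] [NullSingletonClass ν] {s : ℝ}
    (hs0 : 0 < s) (hs1 : s < 1) : ν {t | s ≤ cdf ν t} = ENNReal.ofReal (1 - s) := by
  have hc := continuous_cdf ν
  obtain ⟨a, ha⟩ := ((tendsto_cdf_atBot ν).eventually_lt_const hs0).exists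
  obtain ⟨b, hb⟩ := ((tendsto_cdf_atTop ν).eventually_const_lt hs1).exists
  have hne : {t | cdf ν t = s}.Nonempty :=
    mem_range_of_exists_le_of_exists_ge hc ⟨a, ha.le⟩ ⟨b, hb.le⟩
  have hbdd : BddBelow {t | cdf ν t = s} := by
    refine ⟨a, fun t ht => ?_⟩
    by_contra! h
    have h' := monotone_cdf ν h.le
    rw [ht] at h'
    exact absurd ha (not_lt.2 h')
  have hmem : cdf ν (sInf {t | cdf ν t = s}) = s :=
    (isClosed_eq hc continuous_const).csInf_mem hne hbdd
  -- The distribution function may be flat at level `s`; its leftmost point there makes the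
  -- superlevel set exactly a half-line.
  set r := sInf {t | cdf ν t = s}
  have hset : {t | s ≤ cdf ν t} = (Iio r)ᶜ := by
    ext t
    simp only [mem_ofPred_eq, mem_compl_iff, mem_Iio, not_lt]
    constructor
    · intro h
      by_contra! hlt
      have h1 : cdf ν t = s := le_antisymm (hmem ▸ monotone_cdf ν hlt.le) h
      exact absurd (csInf_le hbdd h1) (not_le.2 hlt)
    · intro h
      exact hmem ▸ monotone_cdf ν h
  rw [hset, prob_compl_eq_one_sub measurableSet_Iio, measure_congr Iio_ae_eq_Iic, ← ofReal_cdf,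
    hmem, ENNReal.ofReal_sub _ hs0.le, ENNReal.ofReal_one]

/-- The ball mass is the distribution function of the distance to `x`, evaluated at that distance;
null spheres say that the distance has no atoms. -/
lemma measure_le_real_closedBall {E : Type*} [PseudoMetricSpace E] [MeasurableSpace E]
    [OpensMeasurableSpace E] (μ : Measure E) [IsProbabilityMeasure μ]
    (x : E) (hμ : ∀ r, μ (Metric.sphere x r) = 0)
    {s : ℝ} (hs0 : 0 < s) (hs1 : s < 1) :
    μ {y | s ≤ μ.real (Metric.closedBall x (dist y x))} = ENNReal.ofReal (1 - s) := by
  have hm : Measurable fun y => dist y x := (continuous_id.dist continuous_const).measurable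
  have : IsProbabilityMeasure (μ.map fun y => dist y x) :=
    Measure.isProbabilityMeasure_map hm.aemeasurable
  have : NullSingletonClass (μ.map fun y => dist y x) :=
    ⟨fun r => by rw [Measure.map_apply hm (measurableSet_singleton r)]; exact hμ r⟩
  rw [← measure_le_cdf (μ.map fun y => dist y x) hs0 hs1, Measure.map_apply hm
    (measurableSet_le measurable_const (monotone_cdf _).measurable)]
  congr 1
  ext y
  simp only [mem_ofPred_eq, mem_preimage, cdf_eq_real, measureReal_def,
    Measure.map_apply hm measurableSet_Iic]
  rfl

/-! ### The mean of the maximum of independent exponential variables -/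

lemma lintegral_exp_mul_one_sub_exp_pow (k : ℕ) :
    ∫⁻ t in Ioi (0 : ℝ), ENNReal.ofReal (Real.exp (-t) * (1 - Real.exp (-t)) ^ k)
      = ENNReal.ofReal ((k + 1 : ℝ)⁻¹) := by
  have hk : (k + 1 : ℝ) ≠ 0 := by positivity
  have hderiv : ∀ t ∈ Ici (0 : ℝ), HasDerivAt
      (fun t : ℝ => (1 - Real.exp (-t)) ^ (k + 1) * (k + 1 : ℝ)⁻¹)
      (Real.exp (-t) * (1 - Real.exp (-t)) ^ k) t := by
    intro t _
    have h := ((((hasDerivAt_neg t).exp).const_sub 1).pow (k + 1)).mul_const ((k + 1 : ℝ)⁻¹)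
    refine h.congr_deriv ?_
    simp only [Nat.add_sub_cancel]
    push_cast
    field_simp
  have hpos : ∀ t ∈ Ioi (0 : ℝ), 0 ≤ Real.exp (-t) * (1 - Real.exp (-t)) ^ k := by
    intro t ht
    have : Real.exp (-t) ≤ 1 := Real.exp_le_one_iff.2 (by linarith [mem_Ioi.1 ht])
    exact mul_nonneg (Real.exp_pos _).le (pow_nonneg (by linarith) _)
  have hlim : Tendsto (fun t : ℝ => (1 - Real.exp (-t)) ^ (k + 1) * (k + 1 : ℝ)⁻¹) atTop
      (𝓝 ((k + 1 : ℝ)⁻¹)) := by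
    have := (((Real.tendsto_exp_neg_atTop_nhds_zero).const_sub 1).pow (k + 1)).mul_const
      ((k + 1 : ℝ)⁻¹)
    simpa using this
  rw [← ofReal_integral_eq_lintegral_ofReal
    (integrableOn_Ioi_deriv_of_nonneg' hderiv hpos hlim)
    ((ae_restrict_iff' measurableSet_Ioi).2 (Eventually.of_forall hpos)),
    integral_Ioi_of_hasDerivAt_of_nonneg' hderiv hpos hlim]
  simp

/-- The integrand is the tail of the maximum of `n` independent standard exponentials. Passing from
`n` to `n + 1` adds `e^{-t} (1 - e^{-t})^n`, whose integral is `1 / (n + 1)`. -/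
lemma lintegral_one_sub_one_sub_exp_pow (n : ℕ) :
    ∫⁻ t in Ioi (0 : ℝ), ENNReal.ofReal (1 - (1 - Real.exp (-t)) ^ n)
      = ENNReal.ofReal (harmonic n : ℝ) := by
  induction n with
  | zero => simp
  | succ n ih =>
    have hsplit : ∀ t ∈ Ioi (0 : ℝ), ENNReal.ofReal (1 - (1 - Real.exp (-t)) ^ (n + 1))
        = ENNReal.ofReal (1 - (1 - Real.exp (-t)) ^ n)
          + ENNReal.ofReal (Real.exp (-t) * (1 - Real.exp (-t)) ^ n) := by
      intro t ht
      have h1 : Real.exp (-t) ≤ 1 := Real.exp_le_one_iff.2 (by linarith [mem_Ioi.1 ht])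
      have h0 := Real.exp_pos (-t)
      have h2 : (1 - Real.exp (-t)) ^ n ≤ 1 := pow_le_one₀ (by linarith) (by linarith)
      rw [← ENNReal.ofReal_add (by linarith)
        (mul_nonneg h0.le (pow_nonneg (by linarith) _))]
      congr 1
      ring
    rw [setLIntegral_congr_fun measurableSet_Ioi hsplit, lintegral_add_left (by fun_prop), ih,
      lintegral_exp_mul_one_sub_exp_pow, ← ENNReal.ofReal_add _ (by positivity), harmonic_succ]
    · push_cast
      rfl
    · exact_mod_cast Finset.sum_nonneg fun i _ => by positivity

/-! ### Product measures -/

/-- Once the first coordinate is fixed, the `n` conditions concern independent coordinates; Fubini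
then integrates the product. -/
lemma pi_measure_forall_mem {E : Type*} [MeasurableSpace E] (μ : Measure E)
    [IsProbabilityMeasure μ] (n : ℕ) {S : Set (E × E)} (hS : MeasurableSet S) :
    Measure.pi (fun _ : Fin (n + 1) => μ) {x | ∀ j : Fin n, (x 0, x j.succ) ∈ S}
      = ∫⁻ a, μ (Prod.mk a ⁻¹' S) ^ n ∂μ := by
  have hmp := measurePreserving_piFinSuccAbove (fun _ : Fin (n + 1) => μ) 0
  have hT : MeasurableSet {p : E × (Fin n → E) | ∀ j : Fin n, (p.1, p.2 j) ∈ S} := by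
    have h : {p : E × (Fin n → E) | ∀ j : Fin n, (p.1, p.2 j) ∈ S}
        = ⋂ j : Fin n, (fun p : E × (Fin n → E) => (p.1, p.2 j)) ⁻¹' S := by
      ext; simp
    rw [h]
    exact MeasurableSet.iInter fun j => (by fun_prop :
      Measurable fun p : E × (Fin n → E) => (p.1, p.2 j)) hS
  calc _ = Measure.pi (fun _ : Fin (n + 1) => μ) (MeasurableEquiv.piFinSuccAbove (fun _ => E) 0 ⁻¹'
        {p : E × (Fin n → E) | ∀ j : Fin n, (p.1, p.2 j) ∈ S}) := by
        congr 1
    _ = _ := by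
      rw [hmp.measure_preimage hT.nullMeasurableSet, Measure.prod_apply hT]
      refine lintegral_congr fun a => ?_
      have h : Prod.mk a ⁻¹' {p : E × (Fin n → E) | ∀ j : Fin n, (p.1, p.2 j) ∈ S}
          = univ.pi fun _ : Fin n => Prod.mk a ⁻¹' S := by
        ext; simp
      rw [h, Measure.pi_pi]
      simp

/-! ### Nearest-neighbour distances -/

lemma nnDist_le {d N : ℕ} (x : Fin N → EuclideanSpace ℝ (Fin d)) {i j : Fin N} (h : j ≠ i) :
    nnDist x i ≤ dist (x i) (x j) :=
  ciInf_le (Set.finite_range _).bddBelow (⟨j, h⟩ : {j : Fin N // j ≠ i})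

lemma nnDist_nonneg {d N : ℕ} (x : Fin N → EuclideanSpace ℝ (Fin d)) (i : Fin N) :
    0 ≤ nnDist x i :=
  Real.iInf_nonneg fun _ => dist_nonneg

lemma exists_nnDist_eq {d n : ℕ} (x : Fin (n + 2) → EuclideanSpace ℝ (Fin d)) (i : Fin (n + 2)) :
    ∃ j ≠ i, nnDist x i = dist (x i) (x j) := by
  obtain ⟨j, hj⟩ := exists_ne i
  have : Nonempty {j : Fin (n + 2) // j ≠ i} := ⟨⟨j, hj⟩⟩
  obtain ⟨⟨k, hk⟩, h⟩ :=
    exists_eq_ciInf_of_finite (f := fun j : {j : Fin (n + 2) // j ≠ i} => dist (x i) (x j))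
  exact ⟨k, hk, h.symm⟩

lemma measurable_nnDist {d N : ℕ} (i : Fin N) :
    Measurable fun x : Fin N → EuclideanSpace ℝ (Fin d) => nnDist x i :=
  Measurable.iInf fun j => (measurable_pi_apply i).dist (measurable_pi_apply j.1)

/-- This equivariance is the source of exchangeability of the nearest-neighbour distances. -/
lemma nnDist_comp_perm {d N : ℕ} (x : Fin N → EuclideanSpace ℝ (Fin d)) (σ : Equiv.Perm (Fin N))
    (i : Fin N) : nnDist (fun j => x (σ j)) i = nnDist x (σ i) := by
  let e : {j : Fin N // j ≠ i} ≃ {j : Fin N // j ≠ σ i} :=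
    σ.subtypeEquiv fun j => by simp
  exact e.iInf_congr fun j => rfl

/-! ### Probabilities of balls -/

lemma measurable_measure_closedBall {α E : Type*} [MeasurableSpace α] [PseudoMetricSpace E]
    [SecondCountableTopology E] [MeasurableSpace E] [OpensMeasurableSpace E] (μ : Measure E)
    [SFinite μ] {g : α → E} {r : α → ℝ} (hg : Measurable g) (hr : Measurable r) :
    Measurable fun a => μ (Metric.closedBall (g a) (r a)) := by
  have h : MeasurableSet {q : α × E | dist q.2 (g q.1) ≤ r q.1} :=
    measurableSet_le (measurable_snd.dist (hg.comp measurable_fst)) (hr.comp measurable_fst)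
  exact measurable_measure_prodMk_left h

lemma measurable_real_closedBall {α E : Type*} [MeasurableSpace α] [PseudoMetricSpace E]
    [SecondCountableTopology E] [MeasurableSpace E] [OpensMeasurableSpace E] (μ : Measure E)
    [SFinite μ] {g : α → E} {r : α → ℝ} (hg : Measurable g) (hr : Measurable r) :
    Measurable fun a => μ.real (Metric.closedBall (g a) (r a)) :=
  (measurable_measure_closedBall μ hg hr).ennreal_toReal

lemma real_closedBall_mono {E : Type*} [PseudoMetricSpace E] [MeasurableSpace E] (μ : Measure E)
    [IsFiniteMeasure μ] (x : E) {r s : ℝ} (h : r ≤ s) :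
    μ.real (Metric.closedBall x r) ≤ μ.real (Metric.closedBall x s) :=
  measureReal_mono (Metric.closedBall_subset_closedBall h)

/-- The probability of the ball around `x 0` that reaches its nearest neighbour. -/
def nnBallProb {d N : ℕ} (μ : Measure (EuclideanSpace ℝ (Fin d)))
    (x : Fin (N + 1) → EuclideanSpace ℝ (Fin d)) : ℝ :=
  μ.real (Metric.closedBall (x 0) (nnDist x 0))

lemma measurable_nnBallProb {d N : ℕ} (μ : Measure (EuclideanSpace ℝ (Fin d))) [SFinite μ] :
    Measurable (nnBallProb (N := N) μ) :=
  measurable_real_closedBall μ (measurable_pi_apply 0) (measurable_nnDist 0)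

lemma nnBallProb_nonneg {d N : ℕ} (μ : Measure (EuclideanSpace ℝ (Fin d)))
    (x : Fin (N + 1) → EuclideanSpace ℝ (Fin d)) : 0 ≤ nnBallProb μ x :=
  measureReal_nonneg

lemma nnBallProb_le_one {d N : ℕ} (μ : Measure (EuclideanSpace ℝ (Fin d))) [IsProbabilityMeasure μ]
    (x : Fin (N + 1) → EuclideanSpace ℝ (Fin d)) : nnBallProb μ x ≤ 1 :=
  measureReal_le_one

/-- Ball mass is monotone in the radius and the minimal distance is attained, so `nnBallProb` is the
minimum of the masses reaching the other points. The event takes the form required by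
`pi_measure_forall_mem`. -/
lemma le_nnBallProb_iff {d n : ℕ} (μ : Measure (EuclideanSpace ℝ (Fin d))) [IsFiniteMeasure μ]
    (x : Fin (n + 2) → EuclideanSpace ℝ (Fin d)) (s : ℝ) :
    s ≤ nnBallProb μ x ↔
      ∀ j : Fin (n + 1), s ≤ μ.real (Metric.closedBall (x 0) (dist (x j.succ) (x 0))) := by
  constructor
  · intro h j
    refine h.trans (real_closedBall_mono μ _ ?_)
    rw [dist_comm]
    exact nnDist_le x (Fin.succ_ne_zero j)
  · intro h
    obtain ⟨j, hj, e⟩ := exists_nnDist_eq x 0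
    obtain ⟨k, rfl⟩ := Fin.exists_succ_eq.2 hj
    rw [nnBallProb, e, dist_comm]
    exact h k

/-- The law of `nnBallProb` is that of the minimum of independent uniform variables. -/
lemma pi_le_nnBallProb {d n : ℕ} (μ : Measure (EuclideanSpace ℝ (Fin d))) [IsProbabilityMeasure μ]
    (hμ : ∀ x r, μ (Metric.sphere x r) = 0) {s : ℝ} (hs0 : 0 < s) (hs1 : s < 1) :
    Measure.pi (fun _ : Fin (n + 2) => μ) {x | s ≤ nnBallProb μ x}
      = ENNReal.ofReal ((1 - s) ^ (n + 1)) := by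
  have hS : MeasurableSet {p : EuclideanSpace ℝ (Fin d) × EuclideanSpace ℝ (Fin d) |
      s ≤ μ.real (Metric.closedBall p.1 (dist p.2 p.1))} :=
    measurableSet_le measurable_const
      (measurable_real_closedBall μ measurable_fst (measurable_snd.dist measurable_fst))
  have h : {x : Fin (n + 2) → EuclideanSpace ℝ (Fin d) | s ≤ nnBallProb μ x}
      = {x | ∀ j : Fin (n + 1), (x 0, x j.succ) ∈
        {p : EuclideanSpace ℝ (Fin d) × EuclideanSpace ℝ (Fin d) |
          s ≤ μ.real (Metric.closedBall p.1 (dist p.2 p.1))}} := by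
    ext x
    exact le_nnBallProb_iff μ x s
  rw [h, pi_measure_forall_mem μ (n + 1) hS]
  simp only [preimage_ofPred_eq, measure_le_real_closedBall μ _ (hμ _) hs0 hs1]
  rw [lintegral_const, measure_univ, mul_one, ENNReal.ofReal_pow (by linarith)]

/-- Let `s` decrease to `0` in the tail formula. Positivity matters because `Real.log 0 = 0` would
distort the logarithmic identities. -/
lemma ae_nnBallProb_pos {d n : ℕ} (μ : Measure (EuclideanSpace ℝ (Fin d))) [IsProbabilityMeasure μ]
    (hμ : ∀ x r, μ (Metric.sphere x r) = 0) :
    ∀ᵐ x ∂Measure.pi (fun _ : Fin (n + 2) => μ), 0 < nnBallProb μ x := by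
  have hm : MeasurableSet {x : Fin (n + 2) → EuclideanSpace ℝ (Fin d) | 0 < nnBallProb μ x} :=
    measurableSet_lt measurable_const (measurable_nnBallProb μ)
  change {x | 0 < nnBallProb μ x} ∈ ae (Measure.pi (fun _ : Fin (n + 2) => μ))
  rw [mem_ae_iff_prob_eq_one hm]
  refine le_antisymm prob_le_one ?_
  have hlim : Tendsto (fun s : ℝ => ENNReal.ofReal ((1 - s) ^ (n + 1))) (𝓝[>] 0) (𝓝 1) := by
    have h : Tendsto (fun s : ℝ => ENNReal.ofReal ((1 - s) ^ (n + 1))) (𝓝 0)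
        (𝓝 (ENNReal.ofReal ((1 - 0) ^ (n + 1)))) :=
      (ENNReal.continuous_ofReal.comp
        (by fun_prop : Continuous fun s : ℝ => (1 - s) ^ (n + 1))).tendsto 0
    simp only [sub_zero, one_pow, ENNReal.ofReal_one] at h
    exact h.mono_left nhdsWithin_le_nhds
  refine le_of_tendsto hlim ?_
  filter_upwards [Ioo_mem_nhdsGT one_pos] with s hs
  rw [← pi_le_nnBallProb (n := n) μ hμ hs.1 hs.2]
  exact measure_mono fun x hx => hs.1.trans_le hx

/-- Layer-cake formula: up to a null set, `-log U > t` is the complement of `U ≥ e^{-t}`, and has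
probability `1 - (1 - e^{-t})^(n + 1)`. -/
lemma lintegral_neg_log_nnBallProb {d n : ℕ} (μ : Measure (EuclideanSpace ℝ (Fin d)))
    [IsProbabilityMeasure μ] (hμ : ∀ x r, μ (Metric.sphere x r) = 0) :
    ∫⁻ x, ENNReal.ofReal (-Real.log (nnBallProb μ x)) ∂Measure.pi (fun _ : Fin (n + 2) => μ)
      = ENNReal.ofReal (harmonic (n + 1) : ℝ) := by
  rw [lintegral_eq_lintegral_meas_lt _ (Eventually.of_forall fun x => neg_nonneg.2
    (Real.log_nonpos (nnBallProb_nonneg μ x) (nnBallProb_le_one μ x)))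
    (measurable_nnBallProb μ).log.neg.aemeasurable, ← lintegral_one_sub_one_sub_exp_pow]
  refine setLIntegral_congr_fun measurableSet_Ioi fun t ht => ?_
  have ht0 : 0 < t := ht
  have hs1 : Real.exp (-t) < 1 := Real.exp_lt_one_iff.2 (by linarith)
  have hm : MeasurableSet {x : Fin (n + 2) → EuclideanSpace ℝ (Fin d) |
      Real.exp (-t) ≤ nnBallProb μ x} :=
    measurableSet_le measurable_const (measurable_nnBallProb μ)
  have hae : {x : Fin (n + 2) → EuclideanSpace ℝ (Fin d) | t < -Real.log (nnBallProb μ x)}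
      =ᵐ[Measure.pi (fun _ : Fin (n + 2) => μ)]
        (({x | Real.exp (-t) ≤ nnBallProb μ x} : Set _)ᶜ : Set _) := by
    filter_upwards [ae_nnBallProb_pos μ hμ] with x hx
    refine propext ?_
    change t < -Real.log (nnBallProb μ x) ↔ ¬ (Real.exp (-t) ≤ nnBallProb μ x)
    rw [not_le, ← Real.log_lt_iff_lt_exp hx]
    constructor <;> intro h <;> linarith
  refine (measure_congr hae).trans ?_
  rw [prob_compl_eq_one_sub hm, pi_le_nnBallProb μ hμ (Real.exp_pos _) hs1,
    ENNReal.ofReal_sub _ (pow_nonneg (by linarith) _), ENNReal.ofReal_one]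

lemma integrable_log_nnBallProb {d n : ℕ} (μ : Measure (EuclideanSpace ℝ (Fin d)))
    [IsProbabilityMeasure μ] (hμ : ∀ x r, μ (Metric.sphere x r) = 0) :
    Integrable (fun x => Real.log (nnBallProb μ x)) (Measure.pi (fun _ : Fin (n + 2) => μ)) := by
  have h : Integrable (fun x => -Real.log (nnBallProb μ x))
      (Measure.pi (fun _ : Fin (n + 2) => μ)) := by
    refine (lintegral_ofReal_ne_top_iff_integrable
      (measurable_nnBallProb μ).log.neg.aestronglyMeasurable
      (Eventually.of_forall fun x => neg_nonneg.2
        (Real.log_nonpos (nnBallProb_nonneg μ x) (nnBallProb_le_one μ x)))).1 ?_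
    refine (lintegral_neg_log_nnBallProb μ hμ).trans_ne ?_
    exact ENNReal.ofReal_ne_top
  simpa using h.neg

lemma integral_log_nnBallProb {d n : ℕ} (μ : Measure (EuclideanSpace ℝ (Fin d)))
    [IsProbabilityMeasure μ] (hμ : ∀ x r, μ (Metric.sphere x r) = 0) :
    ∫ x, Real.log (nnBallProb μ x) ∂Measure.pi (fun _ : Fin (n + 2) => μ)
      = -(harmonic (n + 1) : ℝ) := by
  have h0 : (0 : ℝ) ≤ (harmonic (n + 1) : ℝ) := by
    exact_mod_cast Finset.sum_nonneg fun i _ => by positivity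
  rw [← neg_inj, neg_neg, ← integral_neg, integral_eq_lintegral_of_nonneg_ae
    (Eventually.of_forall fun x => neg_nonneg.2
      (Real.log_nonpos (nnBallProb_nonneg μ x) (nnBallProb_le_one μ x)))
    (measurable_nnBallProb μ).log.neg.aestronglyMeasurable, lintegral_neg_log_nnBallProb μ hμ,
    ENNReal.toReal_ofReal h0]

/-! ### Ball means of a density -/

lemma unitBallVolume_pos (d : ℕ) : 0 < unitBallVolume d :=
  div_pos (Real.rpow_pos_of_pos Real.pi_pos _) (Real.Gamma_pos_of_pos (by positivity))

lemma volume_closedBall_eq {d : ℕ} (hd : 1 ≤ d) (x : EuclideanSpace ℝ (Fin d)) {r : ℝ}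
    (hr : 0 ≤ r) :
    volume (Metric.closedBall x r) = ENNReal.ofReal (r ^ d * unitBallVolume d) := by
  have : Nonempty (Fin d) := ⟨⟨0, hd⟩⟩
  rw [EuclideanSpace.volume_closedBall, Fintype.card_fin, ← ENNReal.ofReal_pow hr,
    ← ENNReal.ofReal_mul (pow_nonneg hr d), unitBallVolume, Real.sqrt_eq_rpow,
    ← Real.rpow_natCast (Real.pi ^ (1 / 2 : ℝ)) d, ← Real.rpow_mul Real.pi_pos.le]
  congr 4
  ring

/-- The law with density `f`. -/
abbrev densityMeasure {d : ℕ} (f : EuclideanSpace ℝ (Fin d) → ℝ) :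
    Measure (EuclideanSpace ℝ (Fin d)) :=
  volume.withDensity fun x => ENNReal.ofReal (f x)

lemma densityMeasure_sphere {d : ℕ} (hd : 1 ≤ d) (f : EuclideanSpace ℝ (Fin d) → ℝ)
    (x : EuclideanSpace ℝ (Fin d)) (r : ℝ) : densityMeasure f (Metric.sphere x r) = 0 := by
  have : Nonempty (Fin d) := ⟨⟨0, hd⟩⟩
  exact withDensity_absolutelyContinuous _ _ (Measure.addHaar_sphere volume x r)

lemma ballMean_eq_div {d : ℕ} (f : EuclideanSpace ℝ (Fin d) → ℝ) (x : EuclideanSpace ℝ (Fin d))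
    (r : ℝ) : ballMean f x r
      = densityMeasure f (Metric.closedBall x r) / ENNReal.ofReal (r ^ d * unitBallVolume d) := by
  rw [ballMean, withDensity_apply _ Metric.isClosed_closedBall.measurableSet]

lemma toReal_ballMean {d : ℕ} (f : EuclideanSpace ℝ (Fin d) → ℝ) (x : EuclideanSpace ℝ (Fin d))
    {r : ℝ} (hr : 0 ≤ r) : (ballMean f x r).toReal
      = (densityMeasure f).real (Metric.closedBall x r) / (r ^ d * unitBallVolume d) := by
  rw [ballMean_eq_div, ENNReal.toReal_div, ENNReal.toReal_ofReal
    (mul_nonneg (pow_nonneg hr _) (unitBallVolume_pos d).le), measureReal_def]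

section Density

variable {d : ℕ} {f : EuclideanSpace ℝ (Fin d) → ℝ}

/-- At the nearest-neighbour radius this identity separates the distribution-free term from the one
that carries the density. -/
lemma log_toReal_ballMean {x : EuclideanSpace ℝ (Fin d)} {r : ℝ} (hr : 0 < r)
    (hF : 0 < (densityMeasure f).real (Metric.closedBall x r)) :
    Real.log (ballMean f x r).toReal = Real.log ((densityMeasure f).real (Metric.closedBall x r))
      - (d * Real.log r + Real.log (unitBallVolume d)) := by
  have hV := unitBallVolume_pos d
  rw [toReal_ballMean f x hr.le, Real.log_div hF.ne' (by positivity),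
    Real.log_mul (by positivity) hV.ne', Real.log_pow]

lemma ae_density_pos (hf : Measurable f) : ∀ᵐ x ∂densityMeasure f, 0 < f x := by
  rw [ae_withDensity_iff hf.ennreal_ofReal]
  exact Eventually.of_forall fun x hx => by
    by_contra! h
    exact hx (ENNReal.ofReal_of_nonpos h)

/-! ### Dyadic versions of the local maximal and minimal functions

Unlike the suprema and infima over all radii, these are visibly measurable. -/

/-- The supremum of the ball means over the radii `R / 2 ^ k`. -/
def dyadicMax {d : ℕ} (f : EuclideanSpace ℝ (Fin d) → ℝ) (R : ℝ)
    (x : EuclideanSpace ℝ (Fin d)) : ℝ≥0∞ :=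
  ⨆ k : ℕ, ballMean f x (R * (1 / 2) ^ k)

/-- The infimum of the ball means over the radii `R / 2 ^ k`. -/
def dyadicMin {d : ℕ} (f : EuclideanSpace ℝ (Fin d) → ℝ) (R : ℝ)
    (x : EuclideanSpace ℝ (Fin d)) : ℝ≥0∞ :=
  ⨅ k : ℕ, ballMean f x (R * (1 / 2) ^ k)

lemma dyadic_radius_mem {R S : ℝ} (hR : 0 < R) (hRS : R ≤ S) (k : ℕ) :
    R * (1 / 2) ^ k ∈ Ioc 0 S := by
  refine ⟨by positivity, (mul_le_of_le_one_right hR.le ?_).trans hRS⟩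
  exact pow_le_one₀ (by norm_num) (by norm_num)

/-- The radii `R ≤ S` are kept distinct because one `R` must later serve both `R₁` and `R₂`. -/
lemma dyadicMax_le_localMax {R S : ℝ} (hR : 0 < R) (hRS : R ≤ S) (x : EuclideanSpace ℝ (Fin d)) :
    dyadicMax f R x ≤ localMax f x S :=
  iSup_le fun k => le_iSup₂ (f := fun r (_ : r ∈ Ioc (0 : ℝ) S) => ballMean f x r) _
    (dyadic_radius_mem hR hRS k)

lemma localMin_le_dyadicMin {R S : ℝ} (hR : 0 < R) (hRS : R ≤ S) (x : EuclideanSpace ℝ (Fin d)) :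
    localMin f x S ≤ dyadicMin f R x :=
  le_iInf fun k => iInf₂_le (f := fun r (_ : r ∈ Ioc (0 : ℝ) S) => ballMean f x r) _
    (dyadic_radius_mem hR hRS k)

lemma measurable_ballMean (r : ℝ) :
    Measurable fun x : EuclideanSpace ℝ (Fin d) => ballMean f x r := by
  simp only [ballMean_eq_div]
  exact (measurable_measure_closedBall (densityMeasure f) measurable_id
    measurable_const).div_const _

lemma measurable_dyadicMax (R : ℝ) : Measurable (dyadicMax f R) :=
  Measurable.iSup fun _ => measurable_ballMean _

lemma measurable_dyadicMin (R : ℝ) : Measurable (dyadicMin f R) :=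
  Measurable.iInf fun _ => measurable_ballMean _

lemma lintegral_dyadicMax_rpow_le (hf : Measurable f) {R S ε : ℝ} (hR : 0 < R) (hRS : R ≤ S)
    (hε : 0 < ε) : ∫⁻ x, dyadicMax f R x ^ ε ∂densityMeasure f ≤ Q f ε S := by
  rw [lintegral_withDensity_eq_lintegral_mul _ hf.ennreal_ofReal
    ((measurable_dyadicMax R).pow_const ε)]
  refine lintegral_mono fun x => ?_
  rw [Pi.mul_apply, mul_comm]
  gcongr
  exact dyadicMax_le_localMax hR hRS x

lemma lintegral_dyadicMin_rpow_le (hf : Measurable f) {R S ε : ℝ} (hR : 0 < R) (hRS : R ≤ S)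
    (hε : 0 < ε) : ∫⁻ x, dyadicMin f R x ^ (-ε) ∂densityMeasure f ≤ T f ε S := by
  rw [lintegral_withDensity_eq_lintegral_mul _ hf.ennreal_ofReal
    ((measurable_dyadicMin R).pow_const (-ε))]
  refine lintegral_mono fun x => ?_
  rw [Pi.mul_apply, mul_comm]
  gcongr ?_ * _
  rw [ENNReal.rpow_neg, ENNReal.rpow_neg, ENNReal.inv_le_inv]
  exact ENNReal.rpow_le_rpow (localMin_le_dyadicMin hR hRS x) hε.le

lemma ae_dyadicMax_ne_top (hf : Measurable f) {ε R S : ℝ} (hε : 0 < ε) (hR : 0 < R)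
    (hRS : R ≤ S) (hQ : Q f ε S < ∞) : ∀ᵐ x ∂densityMeasure f, dyadicMax f R x ≠ ∞ := by
  filter_upwards [ae_lt_top ((measurable_dyadicMax R).pow_const ε)
    ((lintegral_dyadicMax_rpow_le hf hR hRS hε).trans_lt hQ).ne] with x hx h
  rw [h, ENNReal.top_rpow_of_pos hε] at hx
  exact lt_irrefl _ hx

lemma ae_dyadicMin_ne_zero (hf : Measurable f) {ε R S : ℝ} (hε : 0 < ε) (hR : 0 < R)
    (hRS : R ≤ S) (hT : T f ε S < ∞) : ∀ᵐ x ∂densityMeasure f, dyadicMin f R x ≠ 0 := by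
  filter_upwards [ae_lt_top ((measurable_dyadicMin R).pow_const (-ε))
    ((lintegral_dyadicMin_rpow_le hf hR hRS hε).trans_lt hT).ne] with x hx h
  rw [h, ENNReal.zero_rpow_of_neg (by linarith)] at hx
  exact lt_irrefl _ hx

lemma exists_dyadic_radius {r R : ℝ} (hr : 0 < r) (hrR : r ≤ R) :
    ∃ k : ℕ, R * (1 / 2) ^ (k + 1) < r ∧ r ≤ R * (1 / 2) ^ k := by
  have hR : 0 < R := hr.trans_le hrR
  obtain ⟨k, h1, h2⟩ := exists_nat_pow_near_of_lt_one (div_pos hr hR) ((div_le_one hR).2 hrR)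
    (by norm_num : (0 : ℝ) < 1 / 2) (by norm_num)
  exact ⟨k, by rwa [lt_div_iff₀' hR] at h1, by rwa [div_le_iff₀' hR] at h2⟩

/-! ### Bounds for densities of finite mass -/

variable [IsFiniteMeasure (densityMeasure f)]

lemma ballMean_ne_top (x : EuclideanSpace ℝ (Fin d)) {r : ℝ} (hr : 0 < r) :
    ballMean f x r ≠ ∞ := by
  rw [ballMean_eq_div]
  refine ENNReal.div_ne_top (measure_ne_top _ _) ?_
  exact (ENNReal.ofReal_pos.2 (mul_pos (pow_pos hr d) (unitBallVolume_pos d))).ne'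

/-- Ball means at comparable radii are comparable. -/
lemma toReal_ballMean_le (x : EuclideanSpace ℝ (Fin d)) {r s : ℝ} (hr : 0 < r) (hrs : r ≤ s)
    (hsr : s ≤ 2 * r) : (ballMean f x r).toReal ≤ 2 ^ d * (ballMean f x s).toReal := by
  have hs : 0 < s := hr.trans_le hrs
  have hV := unitBallVolume_pos d
  rw [toReal_ballMean f x hr.le, toReal_ballMean f x hs.le, ← mul_div_assoc,
    div_le_div_iff₀ (by positivity) (by positivity)]
  have h1 := real_closedBall_mono (densityMeasure f) x hrs
  have h2 : s ^ d ≤ 2 ^ d * r ^ d := by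
    rw [← mul_pow]; exact pow_le_pow_left₀ hs.le hsr d
  calc _ ≤ (densityMeasure f).real (Metric.closedBall x s)
        * (2 ^ d * r ^ d * unitBallVolume d) := by gcongr
    _ = _ := by ring

/-- The Lebesgue differentiation theorem for the ball means of `f`. -/
lemma ae_tendsto_toReal_ballMean (hd : 1 ≤ d) (hf : Measurable f) (hf0 : ∀ x, 0 ≤ f x) :
    ∀ᵐ x ∂densityMeasure f,
      Tendsto (fun r => (ballMean f x r).toReal) (𝓝[>] 0) (𝓝 (f x)) := by
  refine (withDensity_absolutelyContinuous _ _).ae_le ?_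
  filter_upwards [Besicovitch.ae_tendsto_rnDeriv (densityMeasure f) volume,
    Measure.rnDeriv_withDensity volume hf.ennreal_ofReal] with x hx hx'
  rw [hx'] at hx
  have h := (ENNReal.tendsto_toReal ENNReal.ofReal_ne_top).comp hx
  rw [ENNReal.toReal_ofReal (hf0 x)] at h
  refine h.congr' ?_
  filter_upwards [self_mem_nhdsWithin] with r hr
  rw [Function.comp_apply, volume_closedBall_eq hd x (le_of_lt hr), ← ballMean_eq_div]

/-- Rounding the radius up to a dyadic one costs at most the factor `2 ^ d`. -/
lemma toReal_ballMean_le_dyadicMax {x : EuclideanSpace ℝ (Fin d)} {r R : ℝ} (hr : 0 < r)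
    (hrR : r ≤ R) (hM : dyadicMax f R x ≠ ∞) :
    (ballMean f x r).toReal ≤ 2 ^ d * (dyadicMax f R x).toReal := by
  obtain ⟨k, h1, h2⟩ := exists_dyadic_radius hr hrR
  refine (toReal_ballMean_le x hr h2 (by rw [pow_succ] at h1; linarith)).trans ?_
  gcongr
  exact le_iSup (fun k : ℕ => ballMean f x (R * (1 / 2) ^ k)) k

/-- Here the radius is rounded down, at the same cost. -/
lemma toReal_dyadicMin_le {x : EuclideanSpace ℝ (Fin d)} {r R : ℝ} (hr : 0 < r) (hrR : r ≤ R) :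
    (dyadicMin f R x).toReal ≤ 2 ^ d * (ballMean f x r).toReal := by
  obtain ⟨k, h1, h2⟩ := exists_dyadic_radius hr hrR
  have hk : 0 < R * (1 / 2) ^ (k + 1) := by
    have := hr.trans_le hrR
    positivity
  refine le_trans ?_ (toReal_ballMean_le x hk h1.le (by rw [pow_succ]; linarith))
  refine ENNReal.toReal_mono (ballMean_ne_top x hk) ?_
  exact iInf_le (fun k : ℕ => ballMean f x (R * (1 / 2) ^ k)) (k + 1)

lemma toReal_dyadicMin_pos {x : EuclideanSpace ℝ (Fin d)} {R : ℝ} (hR : 0 < R)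
    (hm : dyadicMin f R x ≠ 0) : 0 < (dyadicMin f R x).toReal := by
  refine ENNReal.toReal_pos hm (ne_top_of_le_ne_top (ballMean_ne_top x (r := R * (1 / 2) ^ 0)
    (by positivity)) (iInf_le _ 0))

lemma toReal_ballMean_pos {x : EuclideanSpace ℝ (Fin d)} {r R : ℝ} (hr : 0 < r) (hrR : r ≤ R)
    (hm : dyadicMin f R x ≠ 0) : 0 < (ballMean f x r).toReal := by
  have h := (toReal_dyadicMin_pos (hr.trans_le hrR) hm).trans_le (toReal_dyadicMin_le hr hrR)
  exact pos_of_mul_pos_right h (by positivity)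

lemma real_closedBall_pos {x : EuclideanSpace ℝ (Fin d)} {r R : ℝ} (hr : 0 < r) (hR : 0 < R)
    (hm : dyadicMin f R x ≠ 0) : 0 < (densityMeasure f).real (Metric.closedBall x r) := by
  have h := toReal_ballMean_pos (lt_min hr hR) (min_le_right r R) hm
  rw [toReal_ballMean f x (lt_min hr hR).le] at h
  have hV := unitBallVolume_pos d
  have h0 : 0 < min r R := lt_min hr hR
  rw [div_pos_iff_of_pos_right (by positivity)] at h
  exact h.trans_le (real_closedBall_mono _ x (min_le_left r R))

/-- A bound for the logarithm of the ball means of radius at most `R`. -/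
def smallBallBound {d : ℕ} (f : EuclideanSpace ℝ (Fin d) → ℝ) (ε₁ ε₂ R : ℝ)
    (x : EuclideanSpace ℝ (Fin d)) : ℝ :=
  d * Real.log 2 + (dyadicMax f R x ^ ε₁).toReal / ε₁ + (dyadicMin f R x ^ (-ε₂)).toReal / ε₂

/-- The inequality `log t ≤ t ^ ε / ε` is applied to the dyadic maximum and to the inverse of the
dyadic minimum; `d log 2` pays for dyadic rounding. -/
lemma abs_log_ballMean_le_smallBallBound {x : EuclideanSpace ℝ (Fin d)} {r R ε₁ ε₂ : ℝ}
    (hr : 0 < r) (hrR : r ≤ R) (hε₁ : 0 < ε₁) (hε₂ : 0 < ε₂)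
    (hM : dyadicMax f R x ≠ ∞) (hm : dyadicMin f R x ≠ 0) :
    |Real.log (ballMean f x r).toReal| ≤ smallBallBound f ε₁ ε₂ R x := by
  have hJ := toReal_ballMean_pos hr hrR hm
  have hm0 := toReal_dyadicMin_pos (hr.trans_le hrR) hm
  have hMJ := toReal_ballMean_le_dyadicMax hr hrR hM
  have hM0 : 0 < (dyadicMax f R x).toReal :=
    pos_of_mul_pos_right (hJ.trans_le hMJ) (by positivity)
  have hlog2 : 0 ≤ d * Real.log 2 := mul_nonneg (by positivity) (Real.log_nonneg (by norm_num))
  have e1 : (dyadicMax f R x ^ ε₁).toReal = (dyadicMax f R x).toReal ^ ε₁ :=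
    (ENNReal.toReal_rpow _ _).symm
  have e2 : (dyadicMin f R x ^ (-ε₂)).toReal = ((dyadicMin f R x).toReal)⁻¹ ^ ε₂ := by
    rw [← ENNReal.toReal_rpow, Real.rpow_neg hm0.le, Real.inv_rpow hm0.le]
  have a1 := Real.log_le_rpow_div hM0.le hε₁
  have a2 := Real.log_le_rpow_div (inv_pos.2 hm0).le hε₂
  have b1 : 0 ≤ (dyadicMax f R x).toReal ^ ε₁ / ε₁ := by positivity
  have b2 : 0 ≤ ((dyadicMin f R x).toReal)⁻¹ ^ ε₂ / ε₂ := by positivity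
  have c1 := Real.log_le_log hJ hMJ
  have c2 := Real.log_le_log hm0 (toReal_dyadicMin_le hr hrR)
  rw [Real.log_mul (by positivity) hM0.ne', Real.log_pow] at c1
  rw [Real.log_mul (by positivity) hJ.ne', Real.log_pow] at c2
  rw [Real.log_inv] at a2
  rw [smallBallBound, e1, e2, abs_le]
  constructor <;> linarith

/-- A bound for the logarithm of the ball means of radius at most `D`. -/
lemma abs_log_ballMean_le [IsProbabilityMeasure (densityMeasure f)]
    {x : EuclideanSpace ℝ (Fin d)} {r R D ε₁ ε₂ : ℝ}
    (hr : 0 < r) (hrD : r ≤ D) (hR : 0 < R) (hε₁ : 0 < ε₁) (hε₂ : 0 < ε₂)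
    (hM : dyadicMax f R x ≠ ∞) (hm : dyadicMin f R x ≠ 0) :
    |Real.log (ballMean f x r).toReal| ≤ smallBallBound f ε₁ ε₂ R x
      + (d * |Real.log R| + |Real.log (unitBallVolume d)|) + d * |Real.log D| := by
  have hd : (0 : ℝ) ≤ d := d.cast_nonneg
  have p1 := mul_nonneg hd (abs_nonneg (Real.log R))
  have p2 := mul_nonneg hd (abs_nonneg (Real.log D))
  have p3 := abs_nonneg (Real.log (unitBallVolume d))
  rcases le_total r R with h | h
  · linarith [abs_log_ballMean_le_smallBallBound hr h hε₁ hε₂ hM hm]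
  -- Beyond `R` the ball mass lies between its value at `R` and `1`, and `log r` between `log R` and
  -- `log D`; the mass at `R` is controlled by the small-radius bound.
  · have hR' := abs_log_ballMean_le_smallBallBound hR le_rfl hε₁ hε₂ hM hm
    have hFR := real_closedBall_pos hR hR hm
    have hFr := real_closedBall_pos hr hR hm
    rw [log_toReal_ballMean hR hFR] at hR'
    rw [log_toReal_ballMean hr hFr]
    have q1 := Real.log_le_log hFR (real_closedBall_mono _ x h)
    have q2 : Real.log ((densityMeasure f).real (Metric.closedBall x r)) ≤ 0 :=
      Real.log_nonpos hFr.le measureReal_le_one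
    have q3 := mul_le_mul_of_nonneg_left (Real.log_le_log hR h) hd
    have q4 := mul_le_mul_of_nonneg_left (Real.log_le_log hr hrD) hd
    have q5 := mul_le_mul_of_nonneg_left (le_abs_self (Real.log D)) hd
    have q6 := mul_le_mul_of_nonneg_left (neg_abs_le (Real.log R)) hd
    have q7 := neg_abs_le (Real.log (unitBallVolume d))
    have q8 := le_abs_self (Real.log (unitBallVolume d))
    have q9 := (abs_nonneg _).trans hR'
    have q10 := (abs_le.1 hR').1
    rw [abs_le]
    constructor <;> linarith

lemma integrable_smallBallBound (hf : Measurable f) {ε₁ ε₂ R R₁ R₂ : ℝ} (hε₁ : 0 < ε₁)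
    (hε₂ : 0 < ε₂) (hR : 0 < R) (hR₁ : R ≤ R₁) (hR₂ : R ≤ R₂) (hQ : Q f ε₁ R₁ < ∞)
    (hT : T f ε₂ R₂ < ∞) : Integrable (smallBallBound f ε₁ ε₂ R) (densityMeasure f) := by
  refine Integrable.add (Integrable.add (integrable_const _) (Integrable.div_const ?_ _))
    (Integrable.div_const ?_ _)
  · exact integrable_toReal_of_lintegral_ne_top
      ((measurable_dyadicMax R).pow_const ε₁).aemeasurable
      ((lintegral_dyadicMax_rpow_le hf hR hR₁ hε₁).trans_lt hQ).ne
  · exact integrable_toReal_of_lintegral_ne_top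
      ((measurable_dyadicMin R).pow_const (-ε₂)).aemeasurable
      ((lintegral_dyadicMin_rpow_le hf hR hR₂ hε₂).trans_lt hT).ne

end Density

/-! ### The logarithm of the distance between two sample points -/

/-- For `t ≥ 1`, `log t ≥ 1 - 1/t` gives `t log t ≥ t - 1`. -/
lemma le_one_add_G (t : ℝ) : t ≤ 1 + G t := by
  unfold G
  split_ifs with h
  · linarith
  · have h1 : 0 < t := by linarith
    have h2 := Real.one_sub_inv_le_log_of_pos h1
    have h3 := mul_le_mul_of_nonneg_left h2 h1.le
    rw [mul_sub, mul_inv_cancel₀ h1.ne'] at h3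
    linarith

lemma measurable_G : Measurable G :=
  Measurable.ite measurableSet_Iio measurable_const (measurable_id.mul Real.measurable_log)

/-- Only a first moment is needed, so `K` is used through `t ≤ 1 + G t` inside and `a ≤ 1 + a ^ (1 +
ε)` outside. -/
lemma lintegral_abs_log_dist_lt_top {d : ℕ} {f : EuclideanSpace ℝ (Fin d) → ℝ}
    [IsProbabilityMeasure (densityMeasure f)] (hf : Measurable f) {ε : ℝ} (hε : 0 < ε)
    (hK : K f ε < ∞) :
    ∫⁻ p, ENNReal.ofReal |Real.log (dist p.1 p.2)|
      ∂((densityMeasure f).prod (densityMeasure f)) < ∞ := by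
  have hG : Measurable fun p : EuclideanSpace ℝ (Fin d) × EuclideanSpace ℝ (Fin d) =>
      ENNReal.ofReal (G |Real.log (dist p.1 p.2)|) :=
    (measurable_G.comp (measurable_fst.dist measurable_snd).log.abs).ennreal_ofReal
  have hin : ∀ x, ∫⁻ y, ENNReal.ofReal (G |Real.log (dist x y)|) ∂densityMeasure f
      = ∫⁻ y, ENNReal.ofReal (G |Real.log (dist x y)|) * ENNReal.ofReal (f y) := fun x => by
    rw [lintegral_withDensity_eq_lintegral_mul_non_measurable _ hf.ennreal_ofReal
      (Eventually.of_forall fun _ => ENNReal.ofReal_lt_top)]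
    refine lintegral_congr fun y => ?_
    rw [Pi.mul_apply, mul_comm]
  have hK' : ∫⁻ x, (∫⁻ y, ENNReal.ofReal (G |Real.log (dist x y)|) ∂densityMeasure f) ^ (1 + ε)
      ∂densityMeasure f = K f ε := by
    rw [lintegral_withDensity_eq_lintegral_mul_non_measurable _ hf.ennreal_ofReal
      (Eventually.of_forall fun _ => ENNReal.ofReal_lt_top), K]
    refine lintegral_congr fun x => ?_
    rw [Pi.mul_apply, mul_comm, hin]
  calc ∫⁻ p, ENNReal.ofReal |Real.log (dist p.1 p.2)|
        ∂((densityMeasure f).prod (densityMeasure f))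
      ≤ ∫⁻ p, (1 + ENNReal.ofReal (G |Real.log (dist p.1 p.2)|))
        ∂((densityMeasure f).prod (densityMeasure f)) := by
        refine lintegral_mono fun p => ?_
        refine (ENNReal.ofReal_le_ofReal (le_one_add_G _)).trans ?_
        exact ENNReal.ofReal_add_le.trans (by rw [ENNReal.ofReal_one])
    _ = 1 + ∫⁻ x, ∫⁻ y, ENNReal.ofReal (G |Real.log (dist x y)|) ∂densityMeasure f
        ∂densityMeasure f := by
        rw [lintegral_add_left measurable_const, lintegral_prod _ hG.aemeasurable]
        simp
    _ ≤ 1 + ∫⁻ x, (1 + (∫⁻ y, ENNReal.ofReal (G |Real.log (dist x y)|) ∂densityMeasure f)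
        ^ (1 + ε)) ∂densityMeasure f := by
        gcongr with x
        rcases le_total (∫⁻ y, ENNReal.ofReal (G |Real.log (dist x y)|) ∂densityMeasure f) 1
          with h | h
        · exact h.trans le_self_add
        · refine le_trans ?_ le_add_self
          conv_lhs => rw [← ENNReal.rpow_one (∫⁻ y, _ ∂_)]
          exact ENNReal.rpow_le_rpow_of_exponent_le h (by linarith)
    _ = 1 + (1 + K f ε) := by
        rw [lintegral_add_left measurable_const, hK']
        simp
    _ < ∞ := by simp [hK]

/-! ### Independent samples -/

/-- All sample sizes use the same sequence of points, and additional points can only bring the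
nearest one closer. -/
lemma nnDist_sample_antitone {Ω : Type*} {d : ℕ}
    {X : ℕ → Ω → EuclideanSpace ℝ (Fin d)} (ω : Ω) :
    Antitone fun n : ℕ => nnDist (fun i : Fin (n + 2) => X i ω) 0 := by
  intro m n hmn
  obtain ⟨j, hj, e⟩ := exists_nnDist_eq (fun i : Fin (m + 2) => X i ω) 0
  simp only [e]
  exact nnDist_le (fun i : Fin (n + 2) => X i ω) (i := 0) (j := Fin.castLE (by omega) j)
    (fun h => hj (Fin.ext (by simpa using congrArg Fin.val h)))

section Sample

variable {Ω : Type*} [MeasurableSpace Ω] {P : Measure Ω} [IsProbabilityMeasure P] {d : ℕ}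
  {X : ℕ → Ω → EuclideanSpace ℝ (Fin d)}

/-- Allowing any injective choice of indices covers reordered samples, as needed for
exchangeability. -/
lemma map_sample_eq_pi {μ : Measure (EuclideanSpace ℝ (Fin d))} (hX_meas : ∀ i, Measurable (X i))
    (hX_indep : iIndepFun X P) (hX_law : ∀ i, P.map (X i) = μ) {N : ℕ} {g : Fin N → ℕ}
    (hg : Function.Injective g) :
    P.map (fun ω i => X (g i) ω) = Measure.pi fun _ => μ := by
  rw [(iIndepFun_iff_map_fun_eq_pi_map fun i => (hX_meas (g i)).aemeasurable).1
    (hX_indep.precomp hg)]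
  simp only [hX_law]

lemma measurable_sample (hX_meas : ∀ i, Measurable (X i)) {N : ℕ} (g : Fin N → ℕ) :
    Measurable fun ω i => X (g i) ω :=
  measurable_pi_lambda _ fun i => hX_meas (g i)

variable {f : EuclideanSpace ℝ (Fin d) → ℝ}

lemma isProbabilityMeasure_of_law {μ : Measure (EuclideanSpace ℝ (Fin d))}
    (hX_meas : ∀ i, Measurable (X i)) (hX_law : ∀ i, P.map (X i) = μ) :
    IsProbabilityMeasure μ :=
  hX_law 0 ▸ Measure.isProbabilityMeasure_map (hX_meas 0).aemeasurable

lemma ae_nnBallProb_sample_pos {μ : Measure (EuclideanSpace ℝ (Fin d))}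
    (hμ : ∀ x r, μ (Metric.sphere x r) = 0) (hX_meas : ∀ i, Measurable (X i))
    (hX_indep : iIndepFun X P) (hX_law : ∀ i, P.map (X i) = μ) :
    ∀ᵐ ω ∂P, ∀ n : ℕ, 0 < nnBallProb μ (fun i : Fin (n + 2) => X i ω) := by
  have := isProbabilityMeasure_of_law hX_meas hX_law
  refine ae_all_iff.2 fun n => ?_
  have h := ae_nnBallProb_pos (n := n) μ hμ
  rw [← map_sample_eq_pi hX_meas hX_indep hX_law Fin.val_injective] at h
  exact ae_of_ae_map (measurable_sample hX_meas _).aemeasurable h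

/-- At distance zero the ball would be a sphere of radius `0`, hence null, contradicting positivity
of its mass. -/
lemma ae_nnDist_sample_pos {μ : Measure (EuclideanSpace ℝ (Fin d))}
    (hμ : ∀ x r, μ (Metric.sphere x r) = 0) (hX_meas : ∀ i, Measurable (X i))
    (hX_indep : iIndepFun X P) (hX_law : ∀ i, P.map (X i) = μ) :
    ∀ᵐ ω ∂P, ∀ n : ℕ, 0 < nnDist (fun i : Fin (n + 2) => X i ω) 0 := by
  filter_upwards [ae_nnBallProb_sample_pos hμ hX_meas hX_indep hX_law] with ω hω n
  refine (nnDist_nonneg _ _).lt_of_ne fun h => (hω n).ne' ?_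
  rw [nnBallProb, ← h, measureReal_def, Metric.closedBall_zero, ← Metric.sphere_zero, hμ,
    ENNReal.toReal_zero]

/-- The probability that the mass never drops below `s` is at most `(1 - s) ^ (n + 1)` for every
`n`. -/
lemma ae_exists_nnBallProb_lt {μ : Measure (EuclideanSpace ℝ (Fin d))}
    (hμ : ∀ x r, μ (Metric.sphere x r) = 0) (hX_meas : ∀ i, Measurable (X i))
    (hX_indep : iIndepFun X P) (hX_law : ∀ i, P.map (X i) = μ) :
    ∀ᵐ ω ∂P, ∀ s > 0, ∃ n : ℕ, nnBallProb μ (fun i : Fin (n + 2) => X i ω) < s := by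
  have := isProbabilityMeasure_of_law hX_meas hX_law
  have key : ∀ k : ℕ, ∀ᵐ ω ∂P, ∃ n : ℕ,
      nnBallProb μ (fun i : Fin (n + 2) => X i ω) < 1 / ((k : ℝ) + 2) := by
    intro k
    -- The shift by `2` keeps `s < 1` even at `k = 0`, as the tail formula requires.
    have hs0 : 0 < 1 / ((k : ℝ) + 2) := by positivity
    have hs1 : 1 / ((k : ℝ) + 2) < 1 := by
      rw [div_lt_one (by positivity)]
      linarith [(Nat.cast_nonneg k : (0 : ℝ) ≤ k)]
    set s : ℝ := 1 / ((k : ℝ) + 2)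
    have hle : ∀ n : ℕ, P {ω | ¬ ∃ n : ℕ, nnBallProb μ (fun i : Fin (n + 2) => X i ω) < s}
        ≤ ENNReal.ofReal ((1 - s) ^ (n + 1)) := by
      intro n
      rw [← pi_le_nnBallProb (n := n) μ hμ hs0 hs1,
        ← map_sample_eq_pi hX_meas hX_indep hX_law Fin.val_injective,
        Measure.map_apply (measurable_sample hX_meas _)
          (measurableSet_le measurable_const (measurable_nnBallProb μ))]
      refine measure_mono fun ω hω => ?_
      by_contra h
      exact hω ⟨n, not_le.1 h⟩
    have hlim : Tendsto (fun n : ℕ => ENNReal.ofReal ((1 - s) ^ (n + 1))) atTop (𝓝 0) := by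
      have h := (tendsto_pow_atTop_nhds_zero_of_lt_one (r := 1 - s) (by linarith)
        (by linarith)).comp (tendsto_add_atTop_nat 1)
      simpa using ENNReal.tendsto_ofReal h
    exact ae_iff.2 (le_antisymm (ge_of_tendsto' hlim hle) zero_le)
  filter_upwards [ae_all_iff.2 key] with ω hω s hs
  obtain ⟨k, hk⟩ := exists_nat_one_div_lt hs
  obtain ⟨n, hn⟩ := hω k
  refine ⟨n, hn.trans (lt_of_le_of_lt ?_ hk)⟩
  gcongr
  norm_num

/-- Balls around almost every point have positive mass, so a small nearest-neighbour ball mass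
forces a small radius; monotonicity in `n` preserves it. -/
lemma ae_tendsto_nnDist_sample {μ : Measure (EuclideanSpace ℝ (Fin d))}
    (hμ : ∀ x r, μ (Metric.sphere x r) = 0) (hX_meas : ∀ i, Measurable (X i))
    (hX_indep : iIndepFun X P) (hX_law : ∀ i, P.map (X i) = μ)
    (hpos : ∀ᵐ x ∂μ, ∀ r > 0, 0 < μ.real (Metric.closedBall x r)) :
    ∀ᵐ ω ∂P, Tendsto (fun n : ℕ => nnDist (fun i : Fin (n + 2) => X i ω) 0) atTop (𝓝[>] 0) := by
  have := isProbabilityMeasure_of_law hX_meas hX_law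
  have hpos' : ∀ᵐ ω ∂P, ∀ r > 0, 0 < μ.real (Metric.closedBall (X 0 ω) r) :=
    ae_of_ae_map (hX_meas 0).aemeasurable (by rw [hX_law 0]; exact hpos)
  filter_upwards [ae_exists_nnBallProb_lt hμ hX_meas hX_indep hX_law, hpos',
    ae_nnDist_sample_pos hμ hX_meas hX_indep hX_law] with ω h1 h2 h3
  refine tendsto_nhdsWithin_iff.2 ⟨?_, Eventually.of_forall h3⟩
  refine Metric.tendsto_atTop.2 fun r hr => ?_
  obtain ⟨n, hn⟩ := h1 _ (h2 r hr)
  refine ⟨n, fun m hm => ?_⟩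
  rw [Real.dist_eq, sub_zero, abs_of_pos (h3 m)]
  refine (nnDist_sample_antitone ω hm).trans_lt ?_
  by_contra! h
  exact absurd hn (not_lt.2 (real_closedBall_mono μ (X 0 ω) h))

lemma integrable_abs_log_dist_sample (hf : Measurable f) (hX_meas : ∀ i, Measurable (X i))
    (hX_indep : iIndepFun X P) (hX_law : ∀ i, P.map (X i) = densityMeasure f) {ε : ℝ}
    (hε : 0 < ε) (hK : K f ε < ∞) :
    Integrable (fun ω => |Real.log (dist (X 0 ω) (X 1 ω))|) P := by
  have := isProbabilityMeasure_of_law hX_meas hX_law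
  have hm : Measurable fun p : EuclideanSpace ℝ (Fin d) × EuclideanSpace ℝ (Fin d) =>
      |Real.log (dist p.1 p.2)| := (measurable_fst.dist measurable_snd).log.abs
  have hmap := (indepFun_iff_map_prod_eq_prod_map_map (hX_meas 0).aemeasurable
    (hX_meas 1).aemeasurable).1 (hX_indep.indepFun zero_ne_one)
  rw [hX_law, hX_law] at hmap
  have h : Integrable (fun p : EuclideanSpace ℝ (Fin d) × EuclideanSpace ℝ (Fin d) =>
      |Real.log (dist p.1 p.2)|) ((densityMeasure f).prod (densityMeasure f)) :=
    (lintegral_ofReal_ne_top_iff_integrable hm.aestronglyMeasurable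
      (Eventually.of_forall fun _ => abs_nonneg _)).1
      (lintegral_abs_log_dist_lt_top hf hε hK).ne
  rw [← hmap] at h
  exact h.comp_measurable ((hX_meas 0).prodMk (hX_meas 1))

lemma measurable_log_ballMean_nnDist (f : EuclideanSpace ℝ (Fin d) → ℝ)
    [IsFiniteMeasure (densityMeasure f)] (N : ℕ) :
    Measurable fun x : Fin (N + 1) → EuclideanSpace ℝ (Fin d) =>
      Real.log (ballMean f (x 0) (nnDist x 0)).toReal := by
  simp only [fun x : Fin (N + 1) → EuclideanSpace ℝ (Fin d) =>
    toReal_ballMean f (x 0) (nnDist_nonneg x 0)]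
  exact ((measurable_nnBallProb (densityMeasure f)).div
    (((measurable_nnDist 0).pow_const d).mul_const _)).log

/-- The logarithm of the ball mean of `f` at the nearest-neighbour distance converges in mean
to `log f`. -/
lemma tendsto_integral_log_ballMean_nnDist (hd : 1 ≤ d) (hf : Measurable f) (hf0 : ∀ x, 0 ≤ f x)
    (hX_meas : ∀ i, Measurable (X i))
    (hX_indep : iIndepFun X P) (hX_law : ∀ i, P.map (X i) = densityMeasure f)
    {ε₀ ε₁ ε₂ R₁ R₂ : ℝ} (hε₀ : 0 < ε₀) (hε₁ : 0 < ε₁) (hε₂ : 0 < ε₂) (hR₁ : 0 < R₁)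
    (hR₂ : 0 < R₂) (hK : K f ε₀ < ∞) (hQ : Q f ε₁ R₁ < ∞) (hT : T f ε₂ R₂ < ∞) :
    (∀ n : ℕ, Integrable (fun ω =>
      Real.log (ballMean f (X 0 ω) (nnDist (fun i : Fin (n + 2) => X i ω) 0)).toReal) P) ∧
    Integrable (fun ω => Real.log (f (X 0 ω))) P ∧
    Tendsto (fun n : ℕ => ∫ ω,
      Real.log (ballMean f (X 0 ω) (nnDist (fun i : Fin (n + 2) => X i ω) 0)).toReal ∂P)
      atTop (𝓝 (∫ ω, Real.log (f (X 0 ω)) ∂P)) := by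
  have := isProbabilityMeasure_of_law hX_meas hX_law
  have hμ := densityMeasure_sphere hd f
  set R := min R₁ R₂
  have hR : 0 < R := lt_min hR₁ hR₂
  have hM := ae_dyadicMax_ne_top hf hε₁ hR (min_le_left R₁ R₂) hQ
  have hm := ae_dyadicMin_ne_zero hf hε₂ hR (min_le_right R₁ R₂) hT
  have transfer : ∀ {p : EuclideanSpace ℝ (Fin d) → Prop}, (∀ᵐ x ∂densityMeasure f, p x) →
      ∀ᵐ ω ∂P, p (X 0 ω) := fun h =>
    ae_of_ae_map (hX_meas 0).aemeasurable ((hX_law 0).symm ▸ h)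
  have hpos : ∀ᵐ x ∂densityMeasure f, ∀ r > 0,
      0 < (densityMeasure f).real (Metric.closedBall x r) := by
    filter_upwards [hm] with x hx r hr
    exact real_closedBall_pos hr hR hx
  -- No `n` appears: the distance to the second sample point dominates every nearest-neighbour
  -- distance.
  set bound : Ω → ℝ := fun ω => smallBallBound f ε₁ ε₂ R (X 0 ω)
    + (d * |Real.log R| + |Real.log (unitBallVolume d)|)
    + d * |Real.log (dist (X 0 ω) (X 1 ω))|
  have hbound_int : Integrable bound P := by
    refine Integrable.add (Integrable.add ?_ (integrable_const _))
      ((integrable_abs_log_dist_sample hf hX_meas hX_indep hX_law hε₀ hK).const_mul _)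
    have h := integrable_smallBallBound hf hε₁ hε₂ hR (min_le_left R₁ R₂) (min_le_right R₁ R₂)
      hQ hT
    rw [← hX_law 0] at h
    exact h.comp_measurable (hX_meas 0)
  have hle : ∀ᵐ ω ∂P, ∀ n : ℕ,
      |Real.log (ballMean f (X 0 ω) (nnDist (fun i : Fin (n + 2) => X i ω) 0)).toReal|
        ≤ bound ω := by
    filter_upwards [transfer hM, transfer hm, ae_nnDist_sample_pos hμ hX_meas hX_indep hX_law]
      with ω h1 h2 h3 n
    exact abs_log_ballMean_le (h3 n)
      (nnDist_le (fun i : Fin (n + 2) => X i ω) (i := 0) (j := 1) one_ne_zero) hR hε₁ hε₂ h1 h2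
  have hlim : ∀ᵐ ω ∂P, Tendsto (fun n : ℕ =>
      Real.log (ballMean f (X 0 ω) (nnDist (fun i : Fin (n + 2) => X i ω) 0)).toReal)
      atTop (𝓝 (Real.log (f (X 0 ω)))) := by
    filter_upwards [transfer (ae_tendsto_toReal_ballMean hd hf hf0), transfer (ae_density_pos hf),
      ae_tendsto_nnDist_sample hμ hX_meas hX_indep hX_law hpos] with ω h1 h2 h3
    exact (h1.comp h3).log h2.ne'
  have hmeas : ∀ n : ℕ, AEStronglyMeasurable (fun ω =>
      Real.log (ballMean f (X 0 ω) (nnDist (fun i : Fin (n + 2) => X i ω) 0)).toReal) P :=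
    fun n => ((measurable_log_ballMean_nnDist f (n + 1)).comp
      (measurable_sample hX_meas fun i : Fin (n + 2) => (i : ℕ))).aestronglyMeasurable
  refine ⟨fun n => hbound_int.mono' (hmeas n) (hle.mono fun ω h => h n), ?_, ?_⟩
  -- The bound passes to the pointwise limit, so `log f(X 0)` is integrable.
  · refine hbound_int.mono' (hf.comp (hX_meas 0)).log.aestronglyMeasurable ?_
    filter_upwards [hle, hlim] with ω h1 h2
    exact le_of_tendsto' h2.abs h1
  · exact tendsto_integral_of_dominated_convergence bound hmeas hbound_int
      (fun n => hle.mono fun ω h => h n) hlim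

/-- The mean logarithmic nearest-neighbour distance of the first sample point. -/
lemma integral_log_nnDist_sample (hd : 1 ≤ d)
    (hX_meas : ∀ i, Measurable (X i)) (hX_indep : iIndepFun X P)
    (hX_law : ∀ i, P.map (X i) = densityMeasure f) (n : ℕ)
    (hJ : Integrable (fun ω =>
      Real.log (ballMean f (X 0 ω) (nnDist (fun i : Fin (n + 2) => X i ω) 0)).toReal) P) :
    Integrable (fun ω => Real.log (nnDist (fun i : Fin (n + 2) => X i ω) 0)) P ∧
    d * ∫ ω, Real.log (nnDist (fun i : Fin (n + 2) => X i ω) 0) ∂P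
      = -(harmonic (n + 1) : ℝ) - Real.log (unitBallVolume d) - ∫ ω,
        Real.log (ballMean f (X 0 ω) (nnDist (fun i : Fin (n + 2) => X i ω) 0)).toReal ∂P := by
  have := isProbabilityMeasure_of_law hX_meas hX_law
  have hμ := densityMeasure_sphere hd f
  have hd0 : (d : ℝ) ≠ 0 := by positivity
  have hmap := map_sample_eq_pi hX_meas hX_indep hX_law (Fin.val_injective (n := n + 2))
  have hms := measurable_sample hX_meas fun i : Fin (n + 2) => (i : ℕ)
  have hU := integrable_log_nnBallProb (n := n) (densityMeasure f) hμ
  have hUint := integral_log_nnBallProb (n := n) (densityMeasure f) hμ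
  rw [← hmap] at hU hUint
  rw [integral_map hms.aemeasurable (measurable_nnBallProb _).log.aestronglyMeasurable] at hUint
  replace hU := hU.comp_measurable hms
  have hdec : ∀ᵐ ω ∂P, (d : ℝ) * Real.log (nnDist (fun i : Fin (n + 2) => X i ω) 0)
      = Real.log (nnBallProb (densityMeasure f) fun i : Fin (n + 2) => X i ω)
        - Real.log (unitBallVolume d)
        - Real.log (ballMean f (X 0 ω) (nnDist (fun i : Fin (n + 2) => X i ω) 0)).toReal := by
    filter_upwards [ae_nnBallProb_sample_pos hμ hX_meas hX_indep hX_law,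
      ae_nnDist_sample_pos hμ hX_meas hX_indep hX_law] with ω h1 h2
    have h := log_toReal_ballMean (f := f) (h2 n) (h1 n)
    simp only [nnBallProb]
    simp only [Fin.val_zero] at h ⊢
    linarith
  have hI := ((hU.sub (integrable_const (Real.log (unitBallVolume d)))).sub hJ)
  constructor
  · have h2 : Integrable (fun ω => (d : ℝ) * Real.log (nnDist (fun i : Fin (n + 2) => X i ω) 0)) P :=
      hI.congr (hdec.mono fun ω h => h.symm)
    have h3 := h2.const_mul (d : ℝ)⁻¹
    simpa only [← mul_assoc, inv_mul_cancel₀ hd0, one_mul] using h3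
  · rw [← integral_const_mul, integral_congr_ae hdec, integral_sub, integral_sub, hUint]
    · simp
    · exact hU
    · exact integrable_const _
    · exact hU.sub (integrable_const _)
    · exact hJ

/-- All points of the sample have identically distributed nearest-neighbour distances. -/
lemma map_nnDist_sample_eq {μ : Measure (EuclideanSpace ℝ (Fin d))}
    (hX_meas : ∀ i, Measurable (X i)) (hX_indep : iIndepFun X P)
    (hX_law : ∀ i, P.map (X i) = μ) {N : ℕ} (i : Fin (N + 1)) :
    P.map (fun ω => nnDist (fun j : Fin (N + 1) => X j ω) i)
      = P.map (fun ω => nnDist (fun j : Fin (N + 1) => X j ω) 0) := by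
  -- Swapping `0` and `i` preserves the product law and moves the `i`-th point to the front.
  have hσ : Function.Injective fun j : Fin (N + 1) => (Equiv.swap 0 i j : ℕ) :=
    Fin.val_injective.comp (Equiv.injective _)
  have h1 := map_sample_eq_pi hX_meas hX_indep hX_law hσ
  rw [← map_sample_eq_pi hX_meas hX_indep hX_law (Fin.val_injective (n := N + 1))] at h1
  have h2 := congrArg (Measure.map fun x => nnDist x 0) h1
  rw [Measure.map_map (measurable_nnDist 0) (measurable_sample hX_meas _),
    Measure.map_map (measurable_nnDist 0) (measurable_sample hX_meas _)] at h2
  refine Eq.trans (congrArg (fun g => P.map g) (funext fun ω => ?_)) h2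
  have := nnDist_comp_perm (fun j : Fin (N + 1) => X j ω) (Equiv.swap 0 i) 0
  rw [Equiv.swap_apply_left] at this
  exact this.symm

lemma log_nnGeomMean {N : ℕ} {x : Fin N → EuclideanSpace ℝ (Fin d)} (hx : ∀ i, 0 < nnDist x i) :
    Real.log (nnGeomMean x) = 1 / (N : ℝ) * ∑ i, Real.log (nnDist x i) := by
  rw [nnGeomMean, Real.log_rpow (Finset.prod_pos fun i _ => hx i),
    Real.log_prod fun i _ => (hx i).ne']

/-- The mean of the estimator in terms of the first nearest-neighbour distance. -/
lemma integral_estimator (hX_meas : ∀ i, Measurable (X i)) (hX_indep : iIndepFun X P)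
    {μ : Measure (EuclideanSpace ℝ (Fin d))} (hμ : ∀ x r, μ (Metric.sphere x r) = 0)
    (hX_law : ∀ i, P.map (X i) = μ) (n : ℕ)
    (hI : Integrable (fun ω => Real.log (nnDist (fun i : Fin (n + 2) => X i ω) 0)) P) :
    Integrable (fun ω => estimator (fun i : Fin (n + 2) => X i ω)) P ∧
    ∫ ω, estimator (fun i : Fin (n + 2) => X i ω) ∂P
      = d * ∫ ω, Real.log (nnDist (fun i : Fin (n + 2) => X i ω) 0) ∂P
        + Real.log (unitBallVolume d) + Real.eulerMascheroniConstant
        + Real.log (((n + 2 : ℕ) : ℝ) - 1) := by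
  have hmeas : ∀ i : Fin (n + 2),
      Measurable fun ω => nnDist (fun j : Fin (n + 2) => X j ω) i := by
    intro i
    have h := (measurable_nnDist (d := d) i).comp
      (measurable_sample hX_meas fun j : Fin (n + 2) => (j : ℕ))
    exact h
  have hlaw := fun i : Fin (n + 2) => map_nnDist_sample_eq hX_meas hX_indep hX_law i
  have hlog : ∀ ν : Measure ℝ, AEStronglyMeasurable Real.log ν :=
    fun ν => Real.measurable_log.aestronglyMeasurable
  have hpos : ∀ᵐ ω ∂P, ∀ i, 0 < nnDist (fun j : Fin (n + 2) => X j ω) i := by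
    refine ae_all_iff.2 fun i => ?_
    -- Positivity is known for the first point and reaches the others through equality of laws.
    have h : ∀ᵐ t ∂P.map (fun ω => nnDist (fun j : Fin (n + 2) => X j ω) 0), 0 < t :=
      (ae_map_iff (hmeas 0).aemeasurable measurableSet_Ioi).2
        ((ae_nnDist_sample_pos hμ hX_meas hX_indep hX_law).mono fun ω h => h n)
    rw [← hlaw i] at h
    exact ae_of_ae_map (hmeas i).aemeasurable h
  have hInt : ∀ i, Integrable (fun ω => Real.log (nnDist (fun j : Fin (n + 2) => X j ω) i)) P := by
    intro i
    have h := (integrable_map_measure (g := Real.log) (hlog _) (hmeas 0).aemeasurable).2 hI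
    rw [← hlaw i] at h
    exact h.comp_measurable (hmeas i)
  have hEq : ∀ i, ∫ ω, Real.log (nnDist (fun j : Fin (n + 2) => X j ω) i) ∂P
      = ∫ ω, Real.log (nnDist (fun j : Fin (n + 2) => X j ω) 0) ∂P := by
    intro i
    rw [← integral_map (hmeas i).aemeasurable (hlog _), hlaw i,
      integral_map (hmeas 0).aemeasurable (hlog _)]
  have hdec : (fun ω => estimator (fun i : Fin (n + 2) => X i ω)) =ᵐ[P] fun ω =>
      d * (1 / ((n + 2 : ℕ) : ℝ) * ∑ i, Real.log (nnDist (fun j : Fin (n + 2) => X j ω) i))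
        + (Real.log (unitBallVolume d) + Real.eulerMascheroniConstant
        + Real.log (((n + 2 : ℕ) : ℝ) - 1)) := by
    filter_upwards [hpos] with ω h
    rw [estimator, log_nnGeomMean h]
    ring
  have hS : Integrable (fun ω => (d : ℝ) * (1 / ((n + 2 : ℕ) : ℝ)
      * ∑ i, Real.log (nnDist (fun j : Fin (n + 2) => X j ω) i))) P :=
    ((integrable_finsetSum _ fun i _ => hInt i).const_mul _).const_mul _
  refine ⟨(hS.add (integrable_const _)).congr hdec.symm, ?_⟩
  rw [integral_congr_ae hdec, integral_add hS (integrable_const _), integral_const_mul,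
    integral_const_mul, integral_finsetSum _ fun i _ => hInt i, Finset.sum_congr rfl
    fun i _ => hEq i]
  have hn : ((n : ℝ) + 2) ≠ 0 := by positivity
  simp only [Finset.sum_const, Finset.card_univ, Fintype.card_fin, nsmul_eq_mul, integral_const,
    probReal_univ, one_smul]
  push_cast
  field_simp
  ring

end Sample

end KozachenkoLeonenko

end

/-! ### Assembly: convergence of the mean of the estimator to the entropy. -/

theorem theorem1 {Ω : Type*} [MeasurableSpace Ω] (P : Measure Ω) [IsProbabilityMeasure P]
    (d : ℕ) (hd : 1 ≤ d)
    (f : EuclideanSpace ℝ (Fin d) → ℝ) (hf_meas : Measurable f) (hf_nonneg : ∀ x, 0 ≤ f x)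
    (X : ℕ → Ω → EuclideanSpace ℝ (Fin d)) (hX_meas : ∀ i, Measurable (X i))
    (hX_indep : iIndepFun X P)
    (hX_law : ∀ i, P.map (X i) = volume.withDensity (fun x => ENNReal.ofReal (f x)))
    (ε₀ ε₁ ε₂ R₁ R₂ : ℝ) (hε₀ : 0 < ε₀) (hε₁ : 0 < ε₁) (hε₂ : 0 < ε₂)
    (hR₁ : 0 < R₁) (hR₂ : 0 < R₂)
    (hK : KozachenkoLeonenko.K f ε₀ < ∞)
    (hQ : KozachenkoLeonenko.Q f ε₁ R₁ < ∞)
    (hT : KozachenkoLeonenko.T f ε₂ R₂ < ∞) :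
    Integrable (fun x => f x * Real.log (f x)) volume ∧
    (∀ᶠ N : ℕ in atTop,
      Integrable (fun ω => KozachenkoLeonenko.estimator (fun i : Fin N => X i ω)) P) ∧
    Tendsto (fun N : ℕ => ∫ ω, KozachenkoLeonenko.estimator (fun i : Fin N => X i ω) ∂P)
      atTop (𝓝 (KozachenkoLeonenko.entropy f)) := by
  have hlaw : ∀ i, P.map (X i) = KozachenkoLeonenko.densityMeasure f := hX_law
  obtain ⟨hJ, hlogf, hlim⟩ := KozachenkoLeonenko.tendsto_integral_log_ballMean_nnDist hd hf_meas
    hf_nonneg hX_meas hX_indep hlaw hε₀ hε₁ hε₂ hR₁ hR₂ hK hQ hT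
  have hnn := fun n => KozachenkoLeonenko.integral_log_nnDist_sample hd hX_meas hX_indep hlaw n
    (hJ n)
  have hest := fun n => KozachenkoLeonenko.integral_estimator hX_meas hX_indep
    (KozachenkoLeonenko.densityMeasure_sphere hd f) hlaw n (hnn n).1
  have hlogm : ∀ ν : Measure (EuclideanSpace ℝ (Fin d)),
      AEStronglyMeasurable (fun x => Real.log (f x)) ν :=
    fun ν => hf_meas.log.aestronglyMeasurable
  have hfin : ∀ᵐ x : EuclideanSpace ℝ (Fin d), ENNReal.ofReal (f x) < ∞ :=
    Eventually.of_forall fun _ => ENNReal.ofReal_lt_top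
  have htoReal : ∀ x, (ENNReal.ofReal (f x)).toReal = f x :=
    fun x => ENNReal.toReal_ofReal (hf_nonneg x)
  have hentropy : ∫ ω, Real.log (f (X 0 ω)) ∂P = -KozachenkoLeonenko.entropy f := by
    rw [← integral_map (f := fun x => Real.log (f x)) (hX_meas 0).aemeasurable (hlogm _), hX_law,
      integral_withDensity_eq_integral_toReal_smul hf_meas.ennreal_ofReal hfin,
      KozachenkoLeonenko.entropy, neg_neg]
    simp only [htoReal, smul_eq_mul]
  refine ⟨?_, ?_, ?_⟩
  · have h := (integrable_map_measure (hlogm _) (hX_meas 0).aemeasurable).2 hlogf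
    rw [hX_law, integrable_withDensity_iff_integrable_smul' hf_meas.ennreal_ofReal hfin] at h
    simpa only [htoReal, smul_eq_mul] using h
  · filter_upwards [eventually_ge_atTop 2] with N hN
    obtain ⟨n, rfl⟩ := Nat.exists_eq_add_of_le' hN
    exact (hest n).1
  -- With `N = n + 2` the mean is `γ - (harmonic (n + 1) - log (n + 1))` minus the mean log ball
  -- mean; the terms in `log V_d` cancel.
  · rw [← tendsto_add_atTop_iff_nat 2]
    have hharm := Real.tendsto_harmonic_sub_log.comp (tendsto_add_atTop_nat 1)
    have h := (hharm.const_sub Real.eulerMascheroniConstant).sub hlim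
    rw [hentropy, sub_self, zero_sub, neg_neg] at h
    refine h.congr fun n => ?_
    rw [(hest n).2, (hnn n).2, Function.comp_apply,
      show ((n + 2 : ℕ) : ℝ) - 1 = ((n + 1 : ℕ) : ℝ) by push_cast; ring]
    ring
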